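/- Let $\Gamma$ be a finitely generated group with a finite symmetric generating set $\Sigma$. A generalized Schreier graph $S$ of $\Gamma$ is a countable union of Schreier graphs of $\Gamma$, that is, the $\Sigma$-edge-labeled graph of an action of $\Gamma$ on a countable set $V(S)$ (the edge with label $\sigma\in\Sigma$ at $v$ leads to $\sigma v$). For a finite set $Q$ and $r\ge 1$ let $U^{r,Q}_{\Gamma,\Sigma}$ be the set of isomorphism classes of rooted, $\Sigma$-edge-labeled, $Q$-vertex-labeled balls of radius $r$ that occur in $Q$-labeled Schreier graphs of $\Gamma$. For an action of $\Gamma$ on a set $V$ and a map $\phi:V\to Q$ let $\mathrm{Conf}_{r,V}(\phi)\subseteq U^{r,Q}_{\Gamma,\Sigma}$ be the set of the classes of the $Q$-labeled $r$-balls around the points of $V$. A sequence $(S_n)_{n\ge1}$ of generalized Schreier graphs is qualitatively convergent if for all finite $Q$, all $r\ge1$ and all $\mathcal A\subseteq U^{r,Q}_{\Gamma,\Sigma}$, either for all large $n$ there is $\phi_n:V(S_n)\to Q$ with $\mathrm{Conf}_{r,S_n}(\phi_n)=\mathcal A$, or for all large $n$ there is no such $\phi_n$. A continuous action of $\Gamma$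 on a topological space $X$ is stable if whenever $\gamma x=x$, the element $\gamma$ fixes every point of some neighbourhood of $x$. Theorem. Let $(S_n)_{n\ge1}$ be a qualitatively convergent sequence of generalized Schreier graphs of $\Gamma$. Then there exist a totally disconnected compact metric space $X$ and a stable action $\beta:\Gamma\curvearrowright X$ such that $(S_n)$ converges qualitatively to $\beta$: for every finite set $Q$, every $r\ge1$ and every $\mathcal A\subseteq U^{r,Q}_{\Gamma,\Sigma}$, there is a continuous map $\psi:X\to Q$ with $\mathrm{Conf}_{r,X}(\psi)=\mathcal A$ if and only if for all large enough $n$ there is a map $\phi_n:V(S_n)\to Q$ with $\mathrm{Conf}_{r,S_n}(\phi_n)=\mathcal A$. Moreover, unless the numbers $|V(S_n)|$ are bounded by a constant for all large $n$, the space $X$ can be chosen to have the cardinality of the continuum. -/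

import Mathlib

open Filter Topology

universe u

/-- A rooted directed graph with edges labelled by `L` and vertices labelled by `Q`. -/
structure RootedLabeledGraph (L Q : Type*) where
  /-- the vertices -/
  Vert : Type u
  /-- `edge l a b`: there is a directed edge from `a` to `b` labelled by `l` -/
  edge : L → Vert → Vert → Prop
  /-- the labels of the vertices -/
  label : Vert → Q
  /-- the root -/
  root : Vert

namespace RootedLabeledGraph

/-- Rooted, edge-labelled and vertex-labelled isomorphism. -/
def Iso {L Q : Type*} (G H : RootedLabeledGraph.{u} L Q) : Prop :=
  ∃ e : G.Vert ≃ H.Vert, e G.root = H.root ∧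
    (∀ l a b, G.edge l a b ↔ H.edge l (e a) (e b)) ∧ ∀ a, H.label (e a) = G.label a

/-- Isomorphism is an equivalence relation. -/
def isoSetoid (L Q : Type*) : Setoid (RootedLabeledGraph.{u} L Q) where
  r := Iso
  iseqv :=
    { refl := fun G => ⟨Equiv.refl _, rfl, fun _ _ _ => Iff.rfl, fun _ => rfl⟩
      symm := by
        rintro G H ⟨e, h1, h2, h3⟩
        refine ⟨e.symm, by simp [← h1], fun l a b => ?_, fun a => ?_⟩
        · rw [h2]; simp
        · rw [← h3]; simp
      trans := by
        rintro G H K ⟨e, h1, h2, h3⟩ ⟨f, k1, k2, k3⟩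
        refine ⟨e.trans f, by simp [h1, k1], fun l a b => ?_, fun a => ?_⟩
        · rw [h2, k2]; rfl
        · simp [h3, k3] }

end RootedLabeledGraph

section SchreierBalls

variable {Γ : Type u} [Group Γ] (S : Finset Γ)

/-- The vertices at distance at most `r` from `x` in the Schreier graph of the action of `Γ` on
`V` with respect to `S`, that is, the endpoints of the `S`-walks of length at most `r` that start
at `x`. (The set `S` will always be symmetric.) -/
def schreierBall {V : Type u} [MulAction Γ V] (r : ℕ) (x : V) : Set V :=
  {y | ∃ w : List Γ, w.length ≤ r ∧ (∀ σ ∈ w, σ ∈ S) ∧ w.prod • x = y}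

/-- The ball of radius `r` around `x` in the Schreier graph of the action of `Γ` on `V`, as a
rooted, `S`-edge-labelled, `Q`-vertex-labelled graph: it is the subgraph induced on the vertices
at distance at most `r` from `x`, the edge labelled by `σ ∈ S` at `a` leads to `σ • a`, and the
vertices are labelled by `φ`. -/
def labeledBall {V : Type u} [MulAction Γ V] {Q : Type} (r : ℕ) (φ : V → Q) (x : V) :
    RootedLabeledGraph.{u} {σ : Γ // σ ∈ S} Q where
  Vert := schreierBall S r x
  edge σ a b := (σ : Γ) • (a : V) = b
  label a := φ a
  root := ⟨x, [], by simp, by simp, by simp⟩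

/-- The set of isomorphism classes of rooted, `S`-edge-labelled, `Q`-vertex-labelled balls of
radius `r` that occur in some `Q`-labelled Schreier graph of `Γ`. Here the Schreier graph of a
subgroup `H` lives on the cosets of `H`, and its root is the coset `H`. -/
def BallClass (r : ℕ) (Q : Type) : Type (u + 1) :=
  {c : Quotient (RootedLabeledGraph.isoSetoid.{u} {σ : Γ // σ ∈ S} Q) //
    ∃ (H : Subgroup Γ) (φ : Γ ⧸ H → Q),
      c = Quotient.mk _ (labeledBall S r φ ((1 : Γ) : Γ ⧸ H))}

/-- The `r`-configuration of a labelling `φ : V → Q`: the set of all labelled balls of radius `r`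
that occur in the labelled graph `(V, φ)`. It is used both for generalized Schreier graphs and
for actions on topological spaces. -/
def Conf {V : Type u} [MulAction Γ V] {Q : Type} (r : ℕ) (φ : V → Q) :
    Set (BallClass S r Q) :=
  {c | ∃ x : V, c.1 = Quotient.mk _ (labeledBall S r φ x)}

end SchreierBalls

/-- A generalized Schreier graph of `Γ`: a countable union of Schreier graphs of `Γ`, that is, the
graph of a (not necessarily transitive) action of `Γ` on a countable set. -/
structure GeneralizedSchreierGraph (Γ : Type u) [Group Γ] where
  /-- the vertices -/
  Vert : Type u
  /-- the action of the group on the vertices -/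
  [action : MulAction Γ Vert]
  /-- there are countably many vertices -/
  [countable : Countable Vert]

attribute [instance] GeneralizedSchreierGraph.action GeneralizedSchreierGraph.countable

/-- The action of the (discrete) group `Γ` on `X` is stable: it is continuous, and if `γ` fixes
`x`, then `γ` fixes every point of some neighbourhood of `x`. -/
structure IsStableAction (Γ : Type u) [Group Γ] (X : Type u) [TopologicalSpace X]
    [MulAction Γ X] : Prop where
  continuous_smul : ∀ γ : Γ, Continuous fun x : X => γ • x
  eventually_fixed : ∀ (γ : Γ) (x : X), γ • x = x → ∀ᶠ y in 𝓝 x, γ • y = y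

/-- Qualitative convergence of a sequence of generalized Schreier graphs: for every finite set `Q`,
every `r ≥ 1` and every set `A` of labelled balls of radius `r`, either `A` is a configuration of
`G n` for all large `n`, or `A` is not a configuration of `G n` for all large `n`. -/
def QualitativelyConvergent {Γ : Type u} [Group Γ] (S : Finset Γ)
    (G : ℕ → GeneralizedSchreierGraph Γ) : Prop :=
  ∀ (Q : Type) [Finite Q] (r : ℕ), 1 ≤ r → ∀ A : Set (BallClass S r Q),
    (∀ᶠ n in atTop, ∃ φ : (G n).Vert → Q, Conf S r φ = A) ∨
      (∀ᶠ n in atTop, ¬ ∃ φ : (G n).Vert → Q, Conf S r φ = A)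

/-- The sequence `G` converges qualitatively to the action of `Γ` on `X`: a set of labelled balls is
the configuration of a continuous labelling of `X` by a finite (discrete) set if and only if it is
a configuration of `G n` for all large `n`. -/
def QualitativelyConvergesTo {Γ : Type u} [Group Γ] (S : Finset Γ)
    (G : ℕ → GeneralizedSchreierGraph Γ) (X : Type u) [TopologicalSpace X]
    [MulAction Γ X] : Prop :=
  ∀ (Q : Type) [Finite Q] [TopologicalSpace Q] [DiscreteTopology Q] (r : ℕ), 1 ≤ r →
    ∀ A : Set (BallClass S r Q),
      (∃ ψ : X → Q, Continuous ψ ∧ Conf S r ψ = A) ↔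
        ∀ᶠ n in atTop, ∃ φ : (G n).Vert → Q, Conf S r φ = A

/-! Choose an ultrafilter `ω` finer than `atTop` and label each vertex set `V n` with values in a
profinite space `L`. Recording labels along orbits maps `V n` equivariantly into the compact shift
`Γ → L`; `X` is the limit of the images along `ω`, a closed invariant set. The label of a vertex has
three components.

For each `γ`, a 4-colouring equals `0` exactly at the fixed points of `γ` and separates every other
`v` from `γ • v`. Both properties are closed conditions, so they survive in the limit
(`DetectsFixedPoints.eq_zero_iff_smul_eq`): being fixed by `γ` is clopen on `X`, which is stability.
Local patterns of continuous labellings therefore have clopen fibres, and the set of patterns on `X`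
is the one seen on `V n` for `ω`-almost all `n` (`eventually_range_localPattern_eq`).

For each finite set of patterns, a labelling realizes it on `V n` whenever that is possible. A
configuration of almost all `V n` thus comes from one coordinate, hence from a continuous labelling
of `X`. Conversely, a continuous labelling of `X` extends to the shift and pulls back to `V n`;
qualitative convergence upgrades "`ω`-almost all `n`" to "all large `n`".

A Cantor-space component, dense in the limit when sizes are unbounded, makes `X` surject onto the
Cantor space. -/

/-! ### Finite data determining labelled balls -/

section LocalPatterns

variable {Γ : Type u} [Group Γ] (S : Finset Γ)

/-- The group elements that are products of at most `r` elements of `S`. -/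
def wordBall (r : ℕ) : Set Γ :=
  {γ | ∃ w : List Γ, w.length ≤ r ∧ (∀ σ ∈ w, σ ∈ S) ∧ w.prod = γ}

theorem wordBall_finite (r : ℕ) : (wordBall S r).Finite := by
  refine ((List.finite_length_le S r).image fun w => (w.map Subtype.val).prod).subset ?_
  rintro γ ⟨w, hw, hS, rfl⟩
  exact ⟨w.attach.map fun σ => ⟨σ.1, hS _ σ.2⟩, by simpa using hw, by
    simp [List.map_map, Function.comp_def]⟩

instance (r : ℕ) : Finite (wordBall S r) := wordBall_finite S r

variable {S} in
theorem wordBall_mono {r s : ℕ} (h : r ≤ s) : wordBall S r ⊆ wordBall S s :=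
  fun _ ⟨w, hw, h'⟩ => ⟨w, hw.trans h, h'⟩

variable {S} in
theorem mul_mem_wordBall {r : ℕ} {σ γ : Γ} (hσ : σ ∈ S) (hγ : γ ∈ wordBall S r) :
    σ * γ ∈ wordBall S (r + 1) := by
  obtain ⟨w, hw, hS, rfl⟩ := hγ
  exact ⟨σ :: w, by simpa using hw, by simpa using ⟨hσ, hS⟩, by simp⟩

variable {S} in
theorem mem_schreierBall_iff {V : Type u} [MulAction Γ V] {r : ℕ} {x y : V} :
    y ∈ schreierBall S r x ↔ ∃ γ ∈ wordBall S r, γ • x = y := by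
  constructor
  · rintro ⟨w, h1, h2, rfl⟩
    exact ⟨_, ⟨w, h1, h2, rfl⟩, rfl⟩
  · rintro ⟨_, ⟨w, h1, h2, rfl⟩, rfl⟩
    exact ⟨w, h1, h2, rfl⟩

/-- Combinatorial data describing a labelled ball of radius `r`: which elements of the word ball
of radius `r + 1` agree at the root, and the labels of the points to which they move the root. -/
abbrev LocalPattern (r : ℕ) (Q : Type) : Type u :=
  Set (wordBall S (r + 1) × wordBall S (r + 1)) × (wordBall S (r + 1) → Q)

/-- The local pattern of a labelling at a point. -/
def localPattern {V : Type u} [MulAction Γ V] {Q : Type} (r : ℕ) (φ : V → Q) (x : V) :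
    LocalPattern S r Q :=
  ({p | (p.1 : Γ) • x = (p.2 : Γ) • x}, fun γ => φ ((γ : Γ) • x))

variable {S} in
theorem localPattern_smul_eq_iff {V W : Type u} [MulAction Γ V] [MulAction Γ W] {Q : Type} {r : ℕ}
    {φ : V → Q} {φ' : W → Q} {x : V} {y : W} (h : localPattern S r φ x = localPattern S r φ' y)
    {a b : Γ} (ha : a ∈ wordBall S (r + 1)) (hb : b ∈ wordBall S (r + 1)) :
    a • x = b • x ↔ a • y = b • y := by
  have := Set.ext_iff.1 (congrArg Prod.fst h) (⟨a, ha⟩, ⟨b, hb⟩)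
  exact this

variable {S} in
-- Send `γ • x` to `γ • y`: the equalities recorded in the pattern make this well defined, injective
-- and edge-preserving.
theorem labeledBall_iso_of_localPattern_eq {V W : Type u} [MulAction Γ V] [MulAction Γ W]
    {Q : Type} {r : ℕ} {φ : V → Q} {φ' : W → Q} {x : V} {y : W}
    (h : localPattern S r φ x = localPattern S r φ' y) :
    (labeledBall S r φ x).Iso (labeledBall S r φ' y) := by
  have hmono := wordBall_mono (S := S) (Nat.le_add_right r 1)
  choose g hg hgx using fun a : schreierBall S r x => mem_schreierBall_iff.1 a.2
  have key : ∀ (a : schreierBall S r x) (γ : Γ), γ ∈ wordBall S (r + 1) → γ • x = a →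
      g a • y = γ • y := fun a γ hγ hγa =>
    (localPattern_smul_eq_iff h (hmono (hg a)) hγ).1 ((hgx a).trans hγa.symm)
  let f : schreierBall S r x → schreierBall S r y := fun a =>
    ⟨g a • y, mem_schreierBall_iff.2 ⟨g a, hg a, rfl⟩⟩
  have hf : Function.Bijective f := by
    constructor
    · intro a b hab
      have hab' : g a • y = g b • y := congrArg Subtype.val hab
      have := (localPattern_smul_eq_iff h (hmono (hg a)) (hmono (hg b))).2 hab'
      exact Subtype.ext (by rw [← hgx a, ← hgx b, this])
    · rintro ⟨b, hb⟩
      obtain ⟨γ, hγ, rfl⟩ := mem_schreierBall_iff.1 hb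
      exact ⟨⟨γ • x, mem_schreierBall_iff.2 ⟨γ, hγ, rfl⟩⟩,
        Subtype.ext (key _ γ (hmono hγ) rfl)⟩
  have hroot : f ⟨x, [], by simp, by simp, by simp⟩ = ⟨y, [], by simp, by simp, by simp⟩ :=
    Subtype.ext ((key _ 1 ⟨[], by simp⟩ (one_smul _ _)).trans (one_smul _ _))
  have hedge : ∀ (σ : {σ : Γ // σ ∈ S}) (a b : schreierBall S r x),
      (σ : Γ) • (a : V) = b ↔ (σ : Γ) • (f a : W) = f b := fun σ a b => by
    change (σ : Γ) • (a : V) = b ↔ (σ : Γ) • (g a • y) = g b • y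
    rw [← hgx a, ← hgx b, ← mul_smul, ← mul_smul]
    -- An edge lengthens a word by one letter, which is why patterns use radius `r + 1`.
    exact localPattern_smul_eq_iff h (mul_mem_wordBall σ.2 (hg a)) (hmono (hg b))
  have hlabel : ∀ a : schreierBall S r x, φ' (f a) = φ a := fun a => by
    have := congrFun (congrArg Prod.snd h) ⟨g a, hmono (hg a)⟩
    change φ (g a • x) = φ' (g a • y) at this
    rw [hgx] at this
    exact this.symm
  exact ⟨Equiv.ofBijective f hf, hroot, hedge, hlabel⟩

variable {S} in
theorem Conf_subset_of_range_localPattern_subset {V W : Type u} [MulAction Γ V] [MulAction Γ W]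
    {Q : Type} {r : ℕ} {φ : V → Q} {φ' : W → Q}
    (h : Set.range (localPattern S r φ) ⊆ Set.range (localPattern S r φ')) :
    Conf S r φ ⊆ Conf S r φ' := by
  rintro c ⟨x, hx⟩
  obtain ⟨y, hy⟩ := h ⟨x, rfl⟩
  exact ⟨y, hx.trans (Quotient.sound (labeledBall_iso_of_localPattern_eq hy.symm))⟩

variable {S} in
theorem Conf_eq_of_range_localPattern_eq {V W : Type u} [MulAction Γ V] [MulAction Γ W]
    {Q : Type} {r : ℕ} {φ : V → Q} {φ' : W → Q}
    (h : Set.range (localPattern S r φ) = Set.range (localPattern S r φ')) :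
    Conf S r φ = Conf S r φ' :=
  (Conf_subset_of_range_localPattern_subset h.le).antisymm
    (Conf_subset_of_range_localPattern_subset h.ge)

theorem range_localPattern_comp {V : Type u} [MulAction Γ V] {Q R : Type} (r : ℕ) (φ : V → Q)
    (e : Q → R) : Set.range (localPattern S r (e ∘ φ)) =
      (fun p : LocalPattern S r Q => ((p.1, e ∘ p.2) : LocalPattern S r R)) ''
        Set.range (localPattern S r φ) := by
  rw [← Set.range_comp]
  rfl

end LocalPatterns

/-! ### Colourings and cardinalities -/

/-- A permutation has a colouring with four colours in which the colour `0` marks the fixed points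
and every other point has a colour different from that of its image. -/
theorem Equiv.Perm.exists_fin_four_coloring {V : Type*} (f : Equiv.Perm V) :
    ∃ c : V → Fin 4, (∀ v, c v = 0 ↔ f v = v) ∧ ∀ v, f v ≠ v → c (f v) ≠ c v := by
  classical
  have avoid : ∀ a b : Fin 4, ∃ d : Fin 4, d ≠ 0 ∧ d ≠ a ∧ d ≠ b := by decide
  choose pick hp0 hpa hpb using avoid
  let lt : V → V → Prop := WellOrderingRel
  let wf : WellFounded lt := IsWellFounded.wf
  -- Greedy colouring along a well-order: only `f v` and `f⁻¹ v` have to be avoided, so three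
  -- nonzero colours suffice. The default `0` for a neighbour not yet coloured excludes nothing new.
  let step : ∀ v, (∀ w, lt w v → Fin 4) → Fin 4 := fun v rec =>
    if f v = v then 0 else
      pick (if h : lt (f v) v then rec _ h else 0) (if h : lt (f.symm v) v then rec _ h else 0)
  let c : V → Fin 4 := wf.fix step
  have hc : ∀ v, c v = if f v = v then 0 else
      pick (if lt (f v) v then c (f v) else 0) (if lt (f.symm v) v then c (f.symm v) else 0) :=
    fun v => (wf.fix_eq step v).trans (by simp [step, c])
  refine ⟨c, fun v => ?_, fun v hv => ?_⟩
  · rw [hc v]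
    split_ifs with h <;> simp [h, hp0]
  · have hv' : f (f v) ≠ f v := fun h => hv (f.injective h)
    rcases trichotomous_of lt (f v) v with h | h | h
    · rw [hc v, if_neg hv, if_pos h]
      exact (hpa _ _).symm
    · exact absurd h hv
    · rw [hc (f v), if_neg hv', f.symm_apply_apply, if_pos h]
      exact hpb _ _

theorem exists_nat_map_of_card (V : Type*) :
    ∃ e : V → ℕ, ∀ j : ℕ, ((j + 1 : ℕ) : ℕ∞) ≤ ENat.card V → j ∈ Set.range e := by
  rcases finite_or_infinite V with h | h
  · refine ⟨fun v => Finite.equivFin V v, fun j hj => ?_⟩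
    rw [ENat.card_eq_coe_natCard] at hj
    have hj' : j < Nat.card V := by exact_mod_cast hj
    exact ⟨(Finite.equivFin V).symm ⟨j, hj'⟩, by simp⟩
  · exact ⟨Function.invFun (Infinite.natEmbedding V), fun j _ =>
      ⟨_, Function.leftInverse_invFun (Infinite.natEmbedding V).injective j⟩⟩

/-- A point is determined by the members of a countable basis that contain it. -/
theorem Cardinal.mk_le_continuum_of_secondCountable (X : Type u) [TopologicalSpace X] [T0Space X]
    [SecondCountableTopology X] : Cardinal.mk X ≤ Cardinal.continuum := by
  have hb := TopologicalSpace.isBasis_countableBasis X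
  let f : X → Set (TopologicalSpace.countableBasis X) := fun x => {U | x ∈ U.1}
  have hf : Function.Injective f := by
    intro x y hxy
    refine (hb.inseparable_iff.2 fun U hU => ?_).eq
    exact Set.ext_iff.1 hxy ⟨U, hU⟩
  refine (Cardinal.mk_le_of_injective hf).trans ?_
  rw [Cardinal.mk_set, ← Cardinal.two_power_aleph0]
  exact Cardinal.power_le_power_left two_ne_zero (Cardinal.mk_le_aleph0_iff.2
    (TopologicalSpace.countable_countableBasis X).to_subtype)

/-! ### Limits of images along an ultrafilter -/

section UltraLimit

variable {V : ℕ → Type u} {K : Type u} [TopologicalSpace K]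

/-- The limit along an ultrafilter of the ranges of a sequence of maps. -/
def ultraLimit (ω : Ultrafilter ℕ) (π : ∀ n, V n → K) : Set K :=
  {x | ∀ U ∈ 𝓝 x, ∀ᶠ n in (ω : Filter ℕ), ∃ v, π n v ∈ U}

variable {ω : Ultrafilter ℕ} {π : ∀ n, V n → K}

theorem eventually_exists_of_mem_ultraLimit {x : K} (hx : x ∈ ultraLimit ω π) {U : Set K}
    (hU : IsOpen U) (hxU : x ∈ U) : ∀ᶠ n in (ω : Filter ℕ), ∃ v, π n v ∈ U :=
  hx U (hU.mem_nhds hxU)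

theorem isClosed_ultraLimit : IsClosed (ultraLimit ω π) := by
  refine isClosed_iff_nhds.2 fun x hx U hU => ?_
  obtain ⟨W, hWU, hW, hxW⟩ := mem_nhds_iff.1 hU
  obtain ⟨y, hyW, hy⟩ := hx W (hW.mem_nhds hxW)
  exact (eventually_exists_of_mem_ultraLimit hy hW hyW).mono
    fun n ⟨v, hv⟩ => ⟨v, hWU hv⟩

theorem ultraLimit_subset_of_isClosed {C : Set K} (hC : IsClosed C) (h : ∀ n v, π n v ∈ C) :
    ultraLimit ω π ⊆ C := by
  intro x hx
  by_contra hxC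
  obtain ⟨n, v, hv⟩ := (eventually_exists_of_mem_ultraLimit hx hC.isOpen_compl hxC).exists
  exact hv (h n v)

/-- Otherwise each point of `C` has a neighbourhood missed for `ω`-almost all `n`; finitely many of
these cover `C`, so `C` itself would be missed. -/
theorem exists_mem_ultraLimit [CompactSpace K] {C : Set K} (hC : IsClosed C)
    (h : ∀ᶠ n in (ω : Filter ℕ), ∃ v, π n v ∈ C) : ∃ x ∈ ultraLimit ω π, x ∈ C := by
  by_contra! hne
  have hU : ∀ x ∈ C, ∃ U ∈ 𝓝 x, ∀ᶠ n in (ω : Filter ℕ), ∀ v, π n v ∉ U := by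
    intro x hxC
    have hx : x ∉ ultraLimit ω π := fun hx => hne x hx hxC
    simp only [ultraLimit, Set.mem_ofPred_eq, not_forall] at hx
    obtain ⟨U, hU, hx⟩ := hx
    refine ⟨U, hU, ?_⟩
    simpa using Ultrafilter.eventually_not.2 hx
  choose! U hUx hU using hU
  obtain ⟨t, ht, hCt⟩ := hC.isCompact.elim_nhds_subcover U hUx
  have : ∀ᶠ n in (ω : Filter ℕ), ∀ x ∈ t, ∀ v, π n v ∉ U x :=
    (Filter.eventually_all_finset t).2 fun x hx => hU x (ht x hx)
  obtain ⟨n, ⟨v, hv⟩, hn⟩ := (h.and this).exists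
  obtain ⟨x, hx, hvx⟩ := Set.mem_iUnion₂.1 (hCt hv)
  exact hn x hx v hvx

theorem eventually_range_eq_image_ultraLimit [CompactSpace K] {P : Type*} [Finite P]
    (p : K → P) (hp : ∀ q, IsClopen (p ⁻¹' {q})) :
    ∀ᶠ n in (ω : Filter ℕ), Set.range (p ∘ π n) = p '' ultraLimit ω π := by
  simp only [Set.ext_iff]
  refine Filter.eventually_all.2 fun q => ?_
  by_cases hq : q ∈ p '' ultraLimit ω π
  · obtain ⟨x, hx, rfl⟩ := hq
    refine (eventually_exists_of_mem_ultraLimit hx (hp (p x)).isOpen rfl).mono ?_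
    rintro n ⟨v, hv⟩
    exact iff_of_true ⟨v, hv⟩ ⟨x, hx, rfl⟩
  · have : ¬ ∀ᶠ n in (ω : Filter ℕ), ∃ v, π n v ∈ p ⁻¹' {q} := fun h => by
      obtain ⟨x, hx, hxq⟩ := exists_mem_ultraLimit (hp q).isClosed h
      exact hq ⟨x, hx, hxq⟩
    refine (Ultrafilter.eventually_not.2 this).mono fun n hn => iff_of_false ?_ hq
    rintro ⟨v, hv⟩
    exact hn ⟨v, hv⟩

theorem smul_mem_ultraLimit {Γ : Type*} [Group Γ] [∀ n, MulAction Γ (V n)] [MulAction Γ K]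
    [ContinuousConstSMul Γ K] (hπ : ∀ n (γ : Γ) v, π n (γ • v) = γ • π n v) (γ : Γ) {x : K}
    (hx : x ∈ ultraLimit ω π) : γ • x ∈ ultraLimit ω π := by
  intro U hU
  refine (hx _ ((continuous_const_smul γ).continuousAt hU)).mono ?_
  rintro n ⟨v, hv⟩
  exact ⟨γ • v, by rw [hπ]; exact hv⟩

end UltraLimit

/-! ### Stability and configurations of the limit action -/

section LimitAction

/-- The local pattern of a labelling, with the fixed points read off from the colourings. -/
def coloredPattern {Γ K : Type u} [Group Γ] [MulAction Γ K] (S : Finset Γ)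
    {Q : Type} (c : Γ → K → Fin 4) (r : ℕ) (f : K → Q)
    (z : K) : LocalPattern S r Q :=
  ({p | c ((p.2 : Γ)⁻¹ * p.1) z = 0}, fun γ => f ((γ : Γ) • z))

theorem localPattern_comp_eq_coloredPattern {Γ K W : Type u} [Group Γ] {S : Finset Γ}
    [MulAction Γ K] [MulAction Γ W] {c : Γ → K → Fin 4} {Q : Type} {r : ℕ} {j : W → K} (hj : ∀ (γ : Γ) x, j (γ • x) = γ • j x)
    (hc : ∀ (γ : Γ) x, γ • x = x ↔ c γ (j x) = 0) (f : K → Q) :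
    localPattern S r (f ∘ j) = coloredPattern S c r f ∘ j := by
  funext x
  refine Prod.ext (Set.ext fun p => ?_) (funext fun γ => congrArg f (hj _ _))
  change (p.1 : Γ) • x = (p.2 : Γ) • x ↔ c ((p.2 : Γ)⁻¹ * p.1) (j x) = 0
  rw [← hc, mul_smul, inv_smul_eq_iff]

variable {Γ : Type u} [Group Γ] {S : Finset Γ} {V : ℕ → Type u} [∀ n, MulAction Γ (V n)]
  {K : Type u} [TopologicalSpace K] [MulAction Γ K] [ContinuousConstSMul Γ K]
  {ω : Ultrafilter ℕ} {π : ∀ n, V n → K} {c : Γ → K → Fin 4}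

/-- A family of colourings that detects the fixed points of all group elements along a sequence of
equivariant maps. -/
structure DetectsFixedPoints (π : ∀ n, V n → K) (c : Γ → K → Fin 4) : Prop where
  map_smul : ∀ n (γ : Γ) (v : V n), π n (γ • v) = γ • π n v
  continuous : ∀ γ, Continuous (c γ)
  eq_zero_iff : ∀ n (γ : Γ) (v : V n), c γ (π n v) = 0 ↔ γ • v = v
  ne_of_smul_ne : ∀ n (γ : Γ) (v : V n), γ • v ≠ v → c γ (γ • π n v) ≠ c γ (π n v)

namespace DetectsFixedPoints

/-- "Colour nonzero or fixed" and "colour zero or colour changed by `γ`" are closed conditions true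
on all images, hence on the limit; a fixed point cannot change its colour. -/
theorem eq_zero_iff_smul_eq [T2Space K] (h : DetectsFixedPoints π c) (γ : Γ) {x : K}
    (hx : x ∈ ultraLimit ω π) : c γ x = 0 ↔ γ • x = x := by
  have hc := h.continuous γ
  have hs : Continuous fun z : K => γ • z := continuous_const_smul γ
  constructor
  · have hC : IsClosed ({z | c γ z = 0}ᶜ ∪ {z | γ • z = z}) :=
      ((isOpen_discrete {(0 : Fin 4)}).preimage hc).isClosed_compl.union
        (isClosed_eq hs continuous_id)
    intro h0
    refine (ultraLimit_subset_of_isClosed hC (fun n v => ?_) hx).resolve_left fun hn => hn h0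
    by_cases hv : γ • v = v
    · exact Or.inr (by rw [Set.mem_ofPred_eq, ← h.map_smul, hv])
    · exact Or.inl fun hv0 => hv ((h.eq_zero_iff n γ v).1 hv0)
  · have hC : IsClosed ({z | c γ z = 0} ∪ {z | c γ (γ • z) = c γ z}ᶜ) :=
      ((isClosed_discrete {(0 : Fin 4)}).preimage hc).union
        (((isOpen_discrete {p : Fin 4 × Fin 4 | p.1 = p.2}).preimage
          ((hc.comp hs).prodMk hc)).isClosed_compl)
    intro hγ
    refine (ultraLimit_subset_of_isClosed hC (fun n v => ?_) hx).resolve_right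
      fun hn => hn (by rw [Set.mem_ofPred_eq, hγ])
    by_cases hv : γ • v = v
    · exact Or.inl ((h.eq_zero_iff n γ v).2 hv)
    · exact Or.inr (h.ne_of_smul_ne n γ v hv)

variable {X : Type u} [MulAction Γ X] {ι : X → K}

theorem smul_eq_iff [TopologicalSpace X] [T2Space K] (h : DetectsFixedPoints π c) (hι : IsEmbedding ι)
    (hιs : ∀ (γ : Γ) x, ι (γ • x) = γ • ι x) (hιr : Set.range ι = ultraLimit ω π)
    (γ : Γ) (x : X) : γ • x = x ↔ c γ (ι x) = 0 := by
  rw [h.eq_zero_iff_smul_eq (ω := ω) γ (hιr ▸ Set.mem_range_self x), ← hιs, hι.injective.eq_iff]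

theorem isStableAction [TopologicalSpace X] [T2Space K] (h : DetectsFixedPoints π c) (hι : IsEmbedding ι)
    (hιs : ∀ (γ : Γ) x, ι (γ • x) = γ • ι x) (hιr : Set.range ι = ultraLimit ω π) :
    IsStableAction Γ X where
  continuous_smul γ := by
    rw [hι.continuous_iff]
    have : ι ∘ (fun x => γ • x) = fun x => γ • ι x := funext (hιs γ)
    exact this ▸ hι.continuous.const_smul γ
  eventually_fixed γ x hx := by
    simp only [h.smul_eq_iff hι hιs hιr] at hx ⊢
    exact ((isOpen_discrete {(0 : Fin 4)}).preimage
      ((h.continuous γ).comp hι.continuous)).mem_nhds hx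

theorem isClopen_coloredPattern_fiber (h : DetectsFixedPoints π c) {Q : Type} [TopologicalSpace Q]
    [DiscreteTopology Q] (r : ℕ) {f : K → Q} (hf : Continuous f) (q : LocalPattern S r Q) :
    IsClopen (coloredPattern S c r f ⁻¹' {q}) := by
  have : coloredPattern S c r f ⁻¹' {q} =
      (⋂ p : wordBall S (r + 1) × wordBall S (r + 1),
        c ((p.2 : Γ)⁻¹ * p.1) ⁻¹' {i | i = 0 ↔ p ∈ q.1}) ∩
      ⋂ γ : wordBall S (r + 1), (fun z => f ((γ : Γ) • z)) ⁻¹' {q.2 γ} := by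
    ext z
    simp only [coloredPattern, Set.mem_preimage, Set.mem_singleton_iff, Set.mem_inter_iff,
      Set.mem_iInter, Prod.ext_iff, Set.ext_iff, funext_iff, Set.mem_ofPred_eq]
  rw [this]
  exact (isClopen_iInter_of_finite fun p => (isClopen_discrete _).preimage (h.continuous _)).inter
    (isClopen_iInter_of_finite fun γ => (isClopen_discrete _).preimage
      (hf.comp (continuous_const_smul _)))

theorem eventually_range_localPattern_eq [TopologicalSpace X] [T2Space K] [CompactSpace K]
    (h : DetectsFixedPoints π c) (hι : IsEmbedding ι)
    (hιs : ∀ (γ : Γ) x, ι (γ • x) = γ • ι x) (hιr : Set.range ι = ultraLimit ω π)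
    {Q : Type} [Finite Q] [TopologicalSpace Q] [DiscreteTopology Q] (r : ℕ) {f : K → Q}
    (hf : Continuous f) :
    ∀ᶠ n in (ω : Filter ℕ), Set.range (localPattern S r (f ∘ π n)) =
      Set.range (localPattern S r (f ∘ ι)) := by
  rw [localPattern_comp_eq_coloredPattern hιs (h.smul_eq_iff hι hιs hιr), Set.range_comp _ ι, hιr]
  filter_upwards [eventually_range_eq_image_ultraLimit (ω := ω) (π := π) (coloredPattern S c r f)
    (h.isClopen_coloredPattern_fiber r hf)] with n hn
  rw [← hn, localPattern_comp_eq_coloredPattern (h.map_smul n) fun γ v => (h.eq_zero_iff n γ v).symm]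

theorem eventually_isEmpty [CompactSpace K] (hιr : Set.range ι = ultraLimit ω π) [IsEmpty X] :
    ∀ᶠ n in (ω : Filter ℕ), IsEmpty (V n) := by
  have : ¬ ∀ᶠ n in (ω : Filter ℕ), ∃ v, π n v ∈ Set.univ := fun h => by
    obtain ⟨x, hx, -⟩ := exists_mem_ultraLimit isClosed_univ h
    rw [← hιr] at hx
    exact isEmptyElim hx.choose
  refine (Ultrafilter.eventually_not.2 this).mono fun n hn => ⟨fun v => hn ⟨v, trivial⟩⟩

theorem isEmpty_of_eventually_isEmpty (hιr : Set.range ι = ultraLimit ω π)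
    (h : ∀ᶠ n in (ω : Filter ℕ), IsEmpty (V n)) : IsEmpty X := by
  refine ⟨fun x => ?_⟩
  have hx : ι x ∈ ultraLimit ω π := hιr ▸ Set.mem_range_self x
  obtain ⟨n, ⟨v, -⟩, hn⟩ :=
    ((eventually_exists_of_mem_ultraLimit hx isOpen_univ trivial).and h).exists
  exact hn.false v

/-- Every continuous labelling of the limit has the same configuration as some labelling of the
approximating actions. -/
theorem eventually_exists_Conf_eq [T2Space K] [CompactSpace K] [TotallyDisconnectedSpace K]
    [TopologicalSpace X] [CompactSpace X] (h : DetectsFixedPoints π c) (hι : IsEmbedding ι)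
    (hιs : ∀ (γ : Γ) x, ι (γ • x) = γ • ι x) (hιr : Set.range ι = ultraLimit ω π)
    {Q : Type} [Finite Q] [TopologicalSpace Q] [DiscreteTopology Q] (r : ℕ) {ψ : X → Q}
    (hψ : Continuous ψ) :
    ∀ᶠ n in (ω : Filter ℕ), ∃ φ : V n → Q, Conf S r φ = Conf S r ψ := by
  -- With `Q` empty, `ψ` cannot extend to `K`, but then `X` and almost all `V n` are empty.
  rcases isEmpty_or_nonempty Q with hQ | hQ
  · have : IsEmpty X := ⟨fun x => hQ.false (ψ x)⟩
    filter_upwards [eventually_isEmpty hιr] with n hn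
    exact ⟨isEmptyElim, Conf_eq_of_range_localPattern_eq (by simp [Set.range_eq_empty])⟩
  -- Lifting over the one-point space extends `ψ` continuously from `X` to `K`.
  · obtain ⟨f, hf, -, hfι⟩ := Profinite.exists_lift_of_finite_of_injective_of_surjective ι
      hι.continuous hι.injective (fun _ : Q => ()) (fun _ => ⟨hQ.some, rfl⟩) ψ hψ
      (fun _ => ()) continuous_const rfl
    filter_upwards [h.eventually_range_localPattern_eq (S := S) hι hιs hιr r hf] with n hn
    exact ⟨f ∘ π n, Conf_eq_of_range_localPattern_eq (by rw [hn, hfι])⟩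

/-- If every pattern set that occurs along the ultrafilter is realized by a continuous labelling,
then so is every configuration. -/
theorem exists_continuous_Conf_eq [TopologicalSpace X] [T2Space K] [CompactSpace K] (h : DetectsFixedPoints π c)
    (hι : IsEmbedding ι) (hιs : ∀ (γ : Γ) x, ι (γ • x) = γ • ι x)
    (hιr : Set.range ι = ultraLimit ω π)
    (hreal : ∀ (r k : ℕ) (T : Set (LocalPattern S r (Fin (k + 1)))),
      (∀ᶠ n in (ω : Filter ℕ), ∃ φ : V n → Fin (k + 1), Set.range (localPattern S r φ) = T) →
      ∃ f : K → Fin (k + 1), Continuous f ∧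
        ∀ᶠ n in (ω : Filter ℕ), Set.range (localPattern S r (f ∘ π n)) = T)
    {Q : Type} [Finite Q] [TopologicalSpace Q] [DiscreteTopology Q] (r : ℕ)
    {A : Set (BallClass S r Q)} (hA : ∀ᶠ n in (ω : Filter ℕ), ∃ φ : V n → Q, Conf S r φ = A) :
    ∃ ψ : X → Q, Continuous ψ ∧ Conf S r ψ = A := by
  rcases isEmpty_or_nonempty Q with hQ | hQ
  · have hV : ∀ᶠ n in (ω : Filter ℕ), IsEmpty (V n) :=
      hA.mono fun n ⟨φ, _⟩ => ⟨fun v => hQ.false (φ v)⟩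
    have := isEmpty_of_eventually_isEmpty hιr hV
    obtain ⟨n, ⟨φ, rfl⟩, hn⟩ := (hA.and hV).exists
    exact ⟨isEmptyElim, continuous_of_discreteTopology,
      Conf_eq_of_range_localPattern_eq (by simp [Set.range_eq_empty])⟩
  · obtain ⟨k, ⟨e⟩⟩ : ∃ k, Nonempty (Q ≃ Fin (k + 1)) := by
      obtain ⟨m, ⟨e⟩⟩ := Finite.exists_equiv_fin Q
      cases m with
      | zero => exact (e hQ.some).elim0
      | succ k => exact ⟨k, ⟨e⟩⟩
    -- There are finitely many sets of patterns, so the ultrafilter selects one that serves almost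
    -- all `n`.
    have hT : ∃ T : Set (LocalPattern S r Q), ∀ᶠ n in (ω : Filter ℕ),
        ∃ φ : V n → Q, Conf S r φ = A ∧ Set.range (localPattern S r φ) = T := by
      classical
      let g : ℕ → Set (LocalPattern S r Q) := fun n =>
        if hn : ∃ φ : V n → Q, Conf S r φ = A then Set.range (localPattern S r hn.choose) else ∅
      obtain ⟨T, hT⟩ := Ultrafilter.eq_pure_of_finite (ω.map g)
      have hT' : ∀ᶠ n in (ω : Filter ℕ), g n = T := by
        have : {T} ∈ ω.map g := by rw [hT]; exact Ultrafilter.mem_pure.2 rfl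
        exact this
      refine ⟨T, ?_⟩
      filter_upwards [hA, hT'] with n hn hgn
      exact ⟨hn.choose, hn.choose_spec, by rw [← hgn]; simp only [g, dif_pos hn]⟩
    obtain ⟨T, hT⟩ := hT
    obtain ⟨f, hf, hfT⟩ := hreal r k _ (hT.mono fun n ⟨φ, _, hφ⟩ =>
      ⟨e ∘ φ, by rw [range_localPattern_comp, hφ]⟩)
    obtain ⟨n, ⟨φ, hφA, hφT⟩, hn, hn'⟩ := (hT.and (hfT.and
      (h.eventually_range_localPattern_eq (S := S) hι hιs hιr r hf))).exists
    refine ⟨e.symm ∘ f ∘ ι, continuous_of_discreteTopology.comp (hf.comp hι.continuous), ?_⟩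
    rw [← hφA]
    refine Conf_eq_of_range_localPattern_eq ?_
    rw [range_localPattern_comp, ← hn', hn, hφT, Set.image_image]
    simp [← Function.comp_assoc]

end DetectsFixedPoints

/-- The image of the limit in the Cantor space is compact and meets every nonempty clopen set, so it
is everything. -/
theorem continuum_le_mk_of_ultraLimit [CompactSpace K] {X : Type u} {ι : X → K}
    (hιr : Set.range ι = ultraLimit ω π) {g : K → ℕ → Bool} (hg : Continuous g)
    (hdense : ∀ U : Set (ℕ → Bool), IsOpen U → U.Nonempty →
      ∀ᶠ n in (ω : Filter ℕ), ∃ v, g (π n v) ∈ U) :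
    Cardinal.continuum ≤ Cardinal.mk X := by
  have hsurj : Function.Surjective fun x => g (ι x) := by
    intro b
    have hcl : IsClosed (g '' ultraLimit ω π) :=
      (isClosed_ultraLimit.isCompact.image hg).isClosed
    have hb : b ∈ g '' ultraLimit ω π := by
      by_contra hb
      obtain ⟨C, hC, hbC, hCU⟩ := compact_exists_isClopen_in_isOpen hcl.isOpen_compl hb
      obtain ⟨x, hx, hxC⟩ := exists_mem_ultraLimit (ω := ω) (π := π) (hC.isClosed.preimage hg)
        (hdense C hC.isOpen ⟨b, hbC⟩)
      exact hCU hxC ⟨x, hx, rfl⟩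
    rw [← hιr] at hb
    obtain ⟨_, ⟨x, rfl⟩, hx⟩ := hb
    exact ⟨x, hx⟩
  have := Cardinal.lift_mk_le_lift_mk_of_surjective hsurj
  simpa using this

end LimitAction

/-! ### The shift space -/

/-- The space of functions on a group, on which the group acts by right translation of the
argument. -/
def GroupShift (Γ L : Type u) : Type u := Γ → L

namespace GroupShift

variable {Γ L : Type u}

instance [TopologicalSpace L] : TopologicalSpace (GroupShift Γ L) :=
  inferInstanceAs (TopologicalSpace (Γ → L))

instance [TopologicalSpace L] [CompactSpace L] : CompactSpace (GroupShift Γ L) :=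
  inferInstanceAs (CompactSpace (Γ → L))

instance [TopologicalSpace L] [T2Space L] : T2Space (GroupShift Γ L) :=
  inferInstanceAs (T2Space (Γ → L))

instance [TopologicalSpace L] [TotallyDisconnectedSpace L] :
    TotallyDisconnectedSpace (GroupShift Γ L) :=
  inferInstanceAs (TotallyDisconnectedSpace (Γ → L))

instance [Countable Γ] [TopologicalSpace L] [SecondCountableTopology L] :
    SecondCountableTopology (GroupShift Γ L) :=
  inferInstanceAs (SecondCountableTopology (Γ → L))

theorem continuous_eval [TopologicalSpace L] (γ : Γ) :
    Continuous fun z : GroupShift Γ L => z γ :=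
  continuous_apply (A := fun _ : Γ => L) γ

variable [Group Γ]

instance : MulAction Γ (GroupShift Γ L) where
  smul g z := fun γ => z (γ * g)
  one_smul z := funext fun γ => congrArg z (mul_one γ)
  mul_smul g h z := funext fun γ => congrArg z (mul_assoc γ g h).symm

instance [TopologicalSpace L] : ContinuousConstSMul Γ (GroupShift Γ L) where
  continuous_const_smul g := continuous_pi fun γ => continuous_eval (γ * g)

/-- The equivariant map to the shift space induced by a labelling. -/
def ofLabel {V : Type u} [MulAction Γ V] (l : V → L) (v : V) : GroupShift Γ L := fun γ => l (γ • v)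

theorem ofLabel_smul {V : Type u} [MulAction Γ V] (l : V → L) (g : Γ) (v : V) :
    (ofLabel l (g • v) : GroupShift Γ L) = g • ofLabel l v :=
  funext fun γ => congrArg l (mul_smul γ g v).symm

theorem ofLabel_one {V : Type u} [MulAction Γ V] (l : V → L) (v : V) :
    (ofLabel l v : GroupShift Γ L) 1 = l v :=
  congrArg l (one_smul Γ v)

end GroupShift

/-- Countability of `Γ` makes the shift second countable, hence the limit metrizable. -/
theorem Group.countable_of_closure_eq_top {Γ : Type*} [Group Γ] (S : Finset Γ)
    (hgen : Subgroup.closure (S : Set Γ) = ⊤) (hsymm : ∀ σ ∈ S, σ⁻¹ ∈ S) : Countable Γ := by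
  refine Function.Surjective.countable (f := fun w : List S => (w.map Subtype.val).prod) fun γ => ?_
  have hγ : γ ∈ Subgroup.closure (S : Set Γ) := hgen ▸ Subgroup.mem_top γ
  induction hγ using Subgroup.closure_induction with
  | mem x hx => exact ⟨[⟨x, hx⟩], by simp⟩
  | one => exact ⟨[], rfl⟩
  | mul x y _ _ hx hy =>
    obtain ⟨w, rfl⟩ := hx
    obtain ⟨w', rfl⟩ := hy
    exact ⟨w ++ w', by simp⟩
  | inv x _ hx =>
    obtain ⟨w, rfl⟩ := hx
    exact ⟨(w.map fun σ => ⟨σ.1⁻¹, hsymm _ σ.2⟩).reverse, by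
      simp [List.prod_inv_reverse, Function.comp_def]⟩

/-- An ultrafilter along which a sequence of types that is frequently large becomes large. -/
theorem exists_ultrafilter_of_frequently_card (V : ℕ → Type*) :
    ∃ ω : Ultrafilter ℕ, (ω : Filter ℕ) ≤ atTop ∧
      ((∀ k : ℕ, ∃ᶠ n in atTop, (k : ℕ∞) ≤ ENat.card (V n)) →
        ∀ k : ℕ, ∀ᶠ n in (ω : Filter ℕ), (k : ℕ∞) ≤ ENat.card (V n)) := by
  by_cases h : ∀ k : ℕ, ∃ᶠ n in atTop, (k : ℕ∞) ≤ ENat.card (V n)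
  · have h' : ∀ k : ℕ, ∃ n, k ≤ n ∧ (k : ℕ∞) ≤ ENat.card (V n) := fun k =>
      (h k).forall_exists_of_atTop k
    choose s hs hcard using h'
    have hs' : Tendsto s atTop atTop := tendsto_atTop_mono hs tendsto_id
    -- Pushing forward along `s` concentrates `ω` on a subsequence whose sizes tend to infinity.
    refine ⟨(hyperfilter ℕ).map s, (Filter.map_mono Nat.hyperfilter_le_atTop).trans hs',
      fun _ k => ?_⟩
    have : ∀ᶠ m in atTop, (k : ℕ∞) ≤ ENat.card (V (s m)) :=
      (eventually_ge_atTop k).mono fun m hm => (Nat.cast_le.2 hm).trans (hcard m)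
    exact Nat.hyperfilter_le_atTop this
  · exact ⟨hyperfilter ℕ, Nat.hyperfilter_le_atTop, fun h' => absurd h' h⟩

/-! ### Universal labels -/

section Labels

variable {Γ : Type u} [Group Γ] (S : Finset Γ)

/-- Index set for the labellings that are built into the limit. -/
abbrev PatternSetIndex : Type u := Σ r k : ℕ, Set (LocalPattern S r (Fin (k + 1)))

/-- The labels used to construct the limit: a colouring for every group element, a label for every
realizable set of patterns, and a point of the Cantor space. -/
abbrev UniversalLabel : Type u :=
  (Γ → Fin 4) × (∀ i : PatternSetIndex S, Fin (i.2.1 + 1)) × (ℕ → Bool)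

/-- Labels that detect fixed points, realize every pattern set that can be realized, and are dense
in the Cantor space as far as the number of points allows. -/
theorem exists_universalLabel (V : Type u) [MulAction Γ V] :
    ∃ l : V → UniversalLabel S,
      (∀ γ v, (l v).1 γ = 0 ↔ γ • v = v) ∧
      (∀ γ v, γ • v ≠ v → (l (γ • v)).1 γ ≠ (l v).1 γ) ∧
      (∀ i : PatternSetIndex S,
        (∃ φ : V → Fin (i.2.1 + 1), Set.range (localPattern S i.1 φ) = i.2.2) →
        Set.range (localPattern S i.1 fun v => (l v).2.1 i) = i.2.2) ∧
      ∀ j : ℕ, ((j + 1 : ℕ) : ℕ∞) ≤ ENat.card V →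
        ∃ v, (l v).2.2 = TopologicalSpace.denseSeq (ℕ → Bool) j := by
  classical
  choose c hc0 hc1 using fun γ : Γ => (MulAction.toPerm γ : Equiv.Perm V).exists_fin_four_coloring
  have hf : ∀ i : PatternSetIndex S, ∃ f : V → Fin (i.2.1 + 1),
      (∃ φ : V → Fin (i.2.1 + 1), Set.range (localPattern S i.1 φ) = i.2.2) →
        Set.range (localPattern S i.1 f) = i.2.2 := fun i => by
    by_cases h : ∃ φ : V → Fin (i.2.1 + 1), Set.range (localPattern S i.1 φ) = i.2.2
    · exact ⟨h.choose, fun _ => h.choose_spec⟩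
    -- A junk labelling for unrealizable sets; it exists because the label set `Fin (k + 1)` is
    -- nonempty.
    · exact ⟨fun _ => 0, fun h' => absurd h' h⟩
  choose f hf using hf
  obtain ⟨e, he⟩ := exists_nat_map_of_card V
  refine ⟨fun v => (fun γ => c γ v, fun i => f i v, TopologicalSpace.denseSeq _ (e v)),
    hc0, hc1, hf, fun j hj => ?_⟩
  obtain ⟨v, rfl⟩ := he j hj
  exact ⟨v, rfl⟩

end Labels

/-! ### The main theorem -/

theorem mainTheorem4 {Γ : Type u} [Group Γ] (S : Finset Γ)
    (hgen : Subgroup.closure (S : Set Γ) = ⊤) (hsymm : ∀ σ ∈ S, σ⁻¹ ∈ S)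
    (G : ℕ → GeneralizedSchreierGraph Γ) (hG : QualitativelyConvergent S G) :
    ∃ (X : Type u) (_ : MetricSpace X) (_ : CompactSpace X) (_ : TotallyDisconnectedSpace X)
      (_ : MulAction Γ X),
      IsStableAction Γ X ∧ QualitativelyConvergesTo S G X ∧
        ((∀ k : ℕ, ∃ᶠ n in atTop, (k : ℕ∞) ≤ ENat.card (G n).Vert) →
          Cardinal.mk X = Cardinal.continuum) := by
  have hΓ : Countable Γ := Group.countable_of_closure_eq_top S hgen hsymm
  obtain ⟨ω, hω, hcard⟩ := exists_ultrafilter_of_frequently_card fun n => (G n).Vert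
  choose l hl0 hl1 hlT hld using fun n => exists_universalLabel S (G n).Vert
  let K := GroupShift Γ (UniversalLabel S)
  let π : ∀ n, (G n).Vert → K := fun n => GroupShift.ofLabel (l n)
  let c : Γ → K → Fin 4 := fun γ z => (z 1).1 γ
  have hπ1 : ∀ n v, π n v 1 = l n v := fun n v => GroupShift.ofLabel_one (l n) v
  have heval : Continuous fun z : K => z 1 := GroupShift.continuous_eval 1
  have hπs : ∀ n (γ : Γ) v, π n (γ • v) = γ • π n v := fun n =>
    GroupShift.ofLabel_smul (l n)
  have hdet : DetectsFixedPoints π c :=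
    { map_smul := hπs
      continuous := fun γ => (continuous_apply γ).comp (continuous_fst.comp heval)
      eq_zero_iff := fun n γ v => by simpa only [c, hπ1] using hl0 n γ v
      ne_of_smul_ne := fun n γ v hv => by simpa only [c, ← hπs, hπ1] using hl1 n γ v hv }
  have hK : SecondCountableTopology K := inferInstance
  let X := ultraLimit ω π
  have hXc : CompactSpace X := isCompact_iff_compactSpace.1 isClosed_ultraLimit.isCompact
  let _ : MulAction Γ X :=
    { smul := fun γ x => ⟨γ • x.1, smul_mem_ultraLimit hπs γ x.2⟩
      one_smul := fun x => Subtype.ext (one_smul Γ x.1)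
      mul_smul := fun g h x => Subtype.ext (mul_smul g h x.1) }
  have hι : IsEmbedding (Subtype.val : X → K) := IsEmbedding.subtypeVal
  have hιs : ∀ (γ : Γ) (x : X), ((γ • x : X) : K) = γ • (x : K) := fun _ _ => rfl
  have hιr : Set.range (Subtype.val : X → K) = ultraLimit ω π := Subtype.range_coe
  refine ⟨X, TopologicalSpace.metrizableSpaceMetric X, hXc, inferInstance, inferInstance,
    hdet.isStableAction hι hιs hιr, ?_, fun hk => le_antisymm
      (Cardinal.mk_le_continuum_of_secondCountable X) ?_⟩
  · intro Q _ _ _ r hr A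
    constructor
    · rintro ⟨ψ, hψ, rfl⟩
      -- Being realized for `ω`-almost all `n` excludes the negative alternative of qualitative
      -- convergence.
      refine (hG Q r hr _).resolve_right fun hno => ?_
      obtain ⟨n, h1, h2⟩ := ((hdet.eventually_exists_Conf_eq hι hιs hιr r hψ).and (hω hno)).exists
      exact h2 h1
    · intro hA
      refine hdet.exists_continuous_Conf_eq hι hιs hιr (fun r k T hT => ?_) r (hω hA)
      let i : PatternSetIndex S := ⟨r, k, T⟩
      refine ⟨fun z => (z 1).2.1 i, (continuous_apply i).comp
        (continuous_fst.comp (continuous_snd.comp heval)), hT.mono fun n hn => ?_⟩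
      simpa only [Function.comp_def, hπ1] using hlT n i hn
  · refine continuum_le_mk_of_ultraLimit hιr (g := fun z => (z 1).2.2)
      (continuous_snd.comp (continuous_snd.comp heval)) fun U hU hne => ?_
    obtain ⟨_, hj, j, rfl⟩ := (TopologicalSpace.denseRange_denseSeq (ℕ → Bool)).inter_open_nonempty
      U hU hne
    filter_upwards [hcard hk (j + 1)] with n hn
    obtain ⟨v, hv⟩ := hld n j hn
    exact ⟨v, by simpa only [hπ1, hv] using hj⟩
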